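/- Let $K$ be a prime number, let $|\psi\rangle$ be a pure (unit-norm) state of $n$ qubits with labels $S=\{1,\dots,n\}$, and let $\varnothing\neq s\subseteq S$. The Generalized Concentratable Entanglement (GCE) of $|\psi\rangle$ on $s$ is $$\mathcal C^{(K)}_{|\psi\rangle}(s)=\frac1{K-1}\Big(1-\frac1{2^{|s|}}\sum_{\alpha\subseteq s}\operatorname{Tr}(\rho_\alpha^K)\Big),$$ where $\rho_\alpha$ is the reduced density matrix of $|\psi\rangle\langle\psi|$ on the qubits in $\alpha$ and $\operatorname{Tr}(\rho_\varnothing^K)=1$. Consider the following circuit on $n$ ancillary $K$-level qudits and $K$ registers of $n$ qubits each. The ancillas start in $|0\rangle$ and the registers in $|\psi'_1\rangle\otimes\cdots\otimes|\psi'_K\rangle$, where each $|\psi'_k\rangle$ is a pure (unit-norm) state. First the Fourier transform $F:|z\rangle\mapsto\frac1{\sqrt K}\sum_{k=0}^{K-1}e^{2\pi i zk/K}|k\rangle$ is applied to every ancilla. Then, for every label $j\in S$ in parallel, the controlled operation $|z\rangle\otimes|\phi\rangle\mapsto|z\rangle\otimes D^z|\phi\rangle$ is applied with ancilla $j$ as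 control and the $K$ qubits with label $j$ as target, where $D|x_1x_2\cdots x_K\rangle=|x_2\cdots x_Kx_1\rangle$. Finally $F^\dagger$ is applied to every ancilla and the ancillas are measured in the computational basis. Let $p(\mathbf z)$, $\mathbf z\in\{0,\dots,K-1\}^n$, be the outcome distribution, and let $$\mathcal C^{(K)}_{|\psi'_1\rangle,\dots,|\psi'_K\rangle}(s)=\frac{K}{2^{|s|}(K-1)^2}\sum_{\alpha\subseteq s}\Big(1-\sum_{\mathbf z:\ \sum_{x\in\alpha}z_x\equiv0\ (\mathrm{mod}\ K)}p(\mathbf z)\Big)$$ be the estimated GCE. Suppose that $\frac12\big\||\psi\rangle\langle\psi|-|\psi'_k\rangle\langle\psi'_k|\big\|_1=\epsilon_k$ for $k=1,\dots,K$, where $\|\cdot\|_1$ is the trace norm. Then $$\Big|\mathcal C^{(K)}_{|\psi'_1\rangle,\dots,|\psi'_K\rangle}(s)-\mathcal C^{(K)}_{|\psi\rangle}(s)\Big|\le\frac{2^{|s|}-1}{(K-1)2^{|s|}}\left(\sum_{m=1}^{K-1}\ \sum_{1\le k_1<\cdots<k_m\le K}\epsilon_{k_1}\cdots\epsilon_{k_m}+2\prod_{k=1}^K\epsilon_k\right).$$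 -/

import Mathlib

open scoped BigOperators

noncomputable section

/-- The space of state vectors of `n` qubits, in the computational basis `Fin n → Fin 2`. -/
abbrev QubitSpace (n : ℕ) : Type := EuclideanSpace ℂ (Fin n → Fin 2)

/-- The density matrix `|ψ⟩⟨ψ|`. -/
def densityMatrix {n : ℕ} (ψ : QubitSpace n) :
    Matrix (Fin n → Fin 2) (Fin n → Fin 2) ℂ :=
  Matrix.of fun x y => ψ x * star (ψ y)

/-- The basis string on all `n` qubits that is `a` on the subsystem `α` and `e` off it. -/
def joinBits {n : ℕ} (α : Finset (Fin n)) (a : {i // i ∈ α} → Fin 2)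
    (e : {i // i ∉ α} → Fin 2) : Fin n → Fin 2 :=
  fun i => if h : i ∈ α then a ⟨i, h⟩ else e ⟨i, h⟩

/-- The reduced matrix on the subsystem `α`: the partial trace over the qubits outside `α`.
For `α = ∅` and a density matrix `ρ` this is the `1 × 1` matrix with entry `Tr ρ = 1`. -/
def reducedMatrix {n : ℕ} (α : Finset (Fin n))
    (ρ : Matrix (Fin n → Fin 2) (Fin n → Fin 2) ℂ) :
    Matrix ({i // i ∈ α} → Fin 2) ({i // i ∈ α} → Fin 2) ℂ :=
  Matrix.of fun a b => ∑ e : {i // i ∉ α} → Fin 2, ρ (joinBits α a e) (joinBits α b e)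

/-- The Generalized Concentratable Entanglement of `ψ` on the subsystem `s`. -/
def gce {n : ℕ} (K : ℕ) (ψ : QubitSpace n) (s : Finset (Fin n)) : ℝ :=
  1 / ((K : ℝ) - 1) *
    (1 - 1 / 2 ^ s.card *
      ∑ α ∈ s.powerset, (Matrix.trace (reducedMatrix α (densityMatrix ψ) ^ K)).re)

/-- The trace norm `‖A‖₁`, the sum of the singular values of `A`. -/
def traceNorm {ι : Type*} [Fintype ι] [DecidableEq ι] (A : Matrix ι ι ℂ) : ℝ :=
  ∑ i, Real.sqrt ((Matrix.isHermitian_conjTranspose_mul_self A).eigenvalues i)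

/-- The trace distance of two pure states. -/
def traceDistance {n : ℕ} (ψ φ : QubitSpace n) : ℝ :=
  1 / 2 * traceNorm (densityMatrix ψ - densityMatrix φ)

/-- The computational basis of the circuit: the digits of the `n` ancillary `K`-level qudits,
and the bits of the `K` copies, `c k j` being the bit of qubit `j` in copy `k`. -/
abbrev CircuitBasis (K n : ℕ) : Type := (Fin n → Fin K) × (Fin K → Fin n → Fin 2)

/-- The quantum Fourier transform of one `K`-level qudit:
`|z⟩ ↦ (1 / √K) ∑ k, ω ^ (z k) |k⟩` with `ω = exp (2 π i / K)`. -/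
def fourierGate (K : ℕ) : Matrix (Fin K) (Fin K) ℂ :=
  Matrix.of fun k z =>
    1 / (Real.sqrt K : ℂ) *
      Complex.exp (2 * Real.pi * Complex.I / K) ^ ((z : ℕ) * (k : ℕ))

/-- The derangement `D` of `K` qubits: the qubit that leaves at position `k` is the one that
entered at position `k + 1` (cyclically), `D |x₁ x₂ ⋯ x_K⟩ = |x₂ ⋯ x_K x₁⟩`. -/
def derangementGate (K : ℕ) : Matrix (Fin K → Fin 2) (Fin K → Fin 2) ℂ :=
  Matrix.of fun y x => if y = fun k => x (finRotate K k) then 1 else 0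

/-- The Fourier transform on each of the ancillas, and the identity on the copies. -/
def fourierLayer (K n : ℕ) : Matrix (CircuitBasis K n) (CircuitBasis K n) ℂ :=
  Matrix.of fun u v => (∏ j, fourierGate K (u.1 j) (v.1 j)) * (if u.2 = v.2 then 1 else 0)

/-- The controlled derangements `|z⟩ ⊗ |φ⟩ ↦ |z⟩ ⊗ D ^ z |φ⟩`, in parallel for all labels `j`:
the control is ancilla `j` and the target consists of the `K` qubits with label `j`. -/
def controlledLayer (K n : ℕ) : Matrix (CircuitBasis K n) (CircuitBasis K n) ℂ :=
  Matrix.of fun u v =>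
    if u.1 = v.1 then
      ∏ j, (derangementGate K ^ (v.1 j : ℕ)) (fun k => u.2 k j) (fun k => v.2 k j)
    else 0

/-- The input of the circuit: every ancilla in `|0⟩`, and the product of the `K` copies. -/
def circuitInput {K n : ℕ} (ψ : Fin K → QubitSpace n) : CircuitBasis K n → ℂ :=
  fun u => (if ∀ j, (u.1 j : ℕ) = 0 then 1 else 0) * ∏ k, ψ k (u.2 k)

/-- The state before the measurement: Fourier transforms, controlled derangements, inverse
Fourier transforms. -/
def circuitOutput {K n : ℕ} (ψ : Fin K → QubitSpace n) : CircuitBasis K n → ℂ :=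
  ((fourierLayer K n).conjTranspose * controlledLayer K n * fourierLayer K n).mulVec
    (circuitInput ψ)

/-- The probability of reading the digit string `z` on the ancillas. -/
def outcomeProb {K n : ℕ} (ψ : Fin K → QubitSpace n) (z : Fin n → Fin K) : ℝ :=
  ∑ c : Fin K → Fin n → Fin 2, ‖circuitOutput ψ (z, c)‖ ^ 2

/-- The GCE on `s` computed from the outcome distribution of the circuit. -/
def estimatedGCE {K n : ℕ} (ψ : Fin K → QubitSpace n) (s : Finset (Fin n)) : ℝ :=
  (K : ℝ) / (2 ^ s.card * ((K : ℝ) - 1) ^ 2) *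
    ∑ α ∈ s.powerset,
      (1 - ∑ z : Fin n → Fin K with K ∣ ∑ x ∈ α, (z x : ℕ), outcomeProb ψ z)

end

/-! The outcome distribution is governed by its characteristic function: twisting `p` by the
character with exponents `a` gives the overlap `⟨Ψ| ∏ D_j^(a_j) |Ψ⟩` of the product input
(`sum_fourierRoot_mul_outcomeProb`). Averaging characters detects divisibility by `K`, so each event
probability is a mean over `t` of overlaps in which `D^t` acts on the qubits in `α`. Such an overlap
is a closed word in the reduced matrices (`shiftOverlap_uniformShift`); as `K` is prime, every `t ≠
0` gives one `K`-cycle, which for equal copies is `Tr (ρ_α ^ K)`. Hence the error is an average over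
`α ⊆ s` and `t ≠ 0` of differences of cyclic traces, and `α = ∅` contributes nothing.

For one difference, write each reduced matrix as that of `ψ` plus the partial trace of a traceless
Hermitian `H k` with trace norm `2 ε k`, and expand over the set `u` of replaced factors. By Hölder,
one factor is measured in trace norm and the others in operator norm. Tracelessness makes the
operator norm at most `ε k` (`norm_reducedMatrix_le`). If some factor is not replaced, it takes the
trace norm, which is 1, and the word costs `∏ k ∈ u, ε k`; if all are replaced, one factor costs `2
ε k`, which doubles the top product. -/

section OperatorNorm

/-! ### Trace norm and ℓ² operator norm of Hermitian matrices -/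

open scoped Matrix.Norms.L2Operator

/-- The trace norm of a Hermitian matrix is the sum of the absolute values of its eigenvalues. -/
theorem traceNorm_eq_sum_abs_eigenvalues {ι : Type*} [Fintype ι] [DecidableEq ι]
    {A : Matrix ι ι ℂ} (hA : A.IsHermitian) : traceNorm A = ∑ i, |hA.eigenvalues i| := by
  have hdiag : A.conjTranspose * A =
      Unitary.conjStarAlgAut ℂ _ hA.eigenvectorUnitary
        (Matrix.diagonal fun i => ((hA.eigenvalues i ^ 2 : ℝ) : ℂ)) := by
    rw [hA.eq]
    conv_lhs => rw [hA.spectral_theorem]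
    rw [← map_mul, Matrix.diagonal_mul_diagonal]
    congr 2
    ext i
    simp [sq]
  -- The two eigenvalue families are enumerated independently, so they are compared as multisets of
  -- characteristic roots.
  have hroots : (A.conjTranspose * A).charpoly.roots =
      Multiset.map (fun i => ((hA.eigenvalues i ^ 2 : ℝ) : ℂ)) Finset.univ.val := by
    rw [hdiag, Unitary.conjStarAlgAut_apply, Matrix.charpoly_mul_comm, ← mul_assoc,
      Unitary.coe_star_mul_self, one_mul, Matrix.charpoly_diagonal, Polynomial.roots_prod]
    · simp only [Polynomial.roots_X_sub_C, Multiset.bind_singleton]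
    · exact Finset.prod_ne_zero_iff.2 fun i _ => Polynomial.X_sub_C_ne_zero _
  rw [(Matrix.isHermitian_conjTranspose_mul_self A).roots_charpoly_eq_eigenvalues] at hroots
  have h := congrArg (fun s : Multiset ℂ => (s.map fun z => Real.sqrt z.re).sum) hroots
  simpa [Multiset.map_map, Real.sqrt_sq_eq_abs, traceNorm, ← Complex.ofReal_pow] using h

/-- A Hermitian matrix is the combination of the projections onto its eigenvectors. -/
theorem Matrix.IsHermitian.apply_eq_sum_eigenvalues {ι : Type*} [Fintype ι] [DecidableEq ι]
    {A : Matrix ι ι ℂ} (hA : A.IsHermitian) (x y : ι) :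
    A x y = ∑ i, (hA.eigenvalues i : ℂ) *
      (hA.eigenvectorBasis i x * star (hA.eigenvectorBasis i y)) := by
  conv_lhs => rw [hA.spectral_theorem, Unitary.conjStarAlgAut_apply]
  rw [Matrix.mul_apply]
  refine Finset.sum_congr rfl fun i _ => ?_
  rw [Matrix.mul_diagonal]
  simp [Matrix.star_apply]
  ring

/-- The operator norm of a Hermitian matrix is bounded by any bound on its quadratic form. -/
theorem Matrix.IsHermitian.norm_le_of_forall_quadratic {ι : Type*} [Fintype ι] [DecidableEq ι]
    {A : Matrix ι ι ℂ} (hA : A.IsHermitian) {c : ℝ} (hc : 0 ≤ c)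
    (h : ∀ v : EuclideanSpace ℂ ι, ‖v‖ = 1 → ‖star (v : ι → ℂ) ⬝ᵥ A.mulVec v‖ ≤ c) : ‖A‖ ≤ c := by
  have hs : IsSelfAdjoint A := hA
  -- Functional calculus bounds the norm by the supremum over the spectrum, so only eigenvectors
  -- need testing.
  rw [← cfc_id ℝ A]
  refine norm_cfc_le hc fun x hx => ?_
  rw [hA.spectrum_real_eq_range_eigenvalues] at hx
  obtain ⟨i, rfl⟩ := hx
  have h1 := h (hA.eigenvectorBasis i) (hA.eigenvectorBasis.orthonormal.1 i)
  simp only [id, Real.norm_eq_abs]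
  rw [hA.eigenvalues_eq]
  exact (Complex.abs_re_le_norm _).trans h1

/-! ### Cyclic words of matrices -/

theorem norm_list_ofFn_prod_le {R : Type*} [NormedRing R] (h1 : ‖(1 : R)‖ ≤ 1) :
    ∀ {m : ℕ} (B : Fin m → R) (b : Fin m → ℝ), (∀ i, ‖B i‖ ≤ b i) →
      ‖(List.ofFn B).prod‖ ≤ ∏ i, b i
  | 0, B, b, h => by simpa using h1
  | m + 1, B, b, h => by
    rw [List.ofFn_succ, List.prod_cons, Fin.prod_univ_succ]
    exact (norm_mul_le _ _).trans (mul_le_mul (h 0)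
      (norm_list_ofFn_prod_le h1 (fun i => B i.succ) (fun i => b i.succ) fun i => h _)
      (norm_nonneg _) ((norm_nonneg _).trans (h 0)))

/-- Sum over paths from `a` to `b` with interior vertices `y`: `Fin.cons a y` lists the sources of
the steps, `Fin.snoc y b` their targets. Setting `b = a` closes the path, and the targets become the
rotated sources. -/
theorem list_ofFn_prod_apply {ι R : Type*} [Fintype ι] [DecidableEq ι] [CommRing R] :
    ∀ {m : ℕ} (B : Fin (m + 1) → Matrix ι ι R) (a b : ι), (List.ofFn B).prod a b =
      ∑ y : Fin m → ι, ∏ i, B i (Fin.cons (α := fun _ => ι) a y i)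
        (Fin.snoc (α := fun _ => ι) y b i)
  | 0, B, a, b => by simp [Fin.snoc]
  | m + 1, B, a, b => by
    rw [List.ofFn_succ, List.prod_cons, Matrix.mul_apply,
      ← (Fin.consEquiv fun _ : Fin (m + 1) => ι).sum_comp, Fintype.sum_prod_type]
    refine Finset.sum_congr rfl fun c _ => ?_
    rw [list_ofFn_prod_apply, Finset.mul_sum]
    refine Finset.sum_congr rfl fun y _ => ?_
    rw [Fin.prod_univ_succ (n := m + 1)]
    have hc : (Fin.consEquiv fun _ : Fin (m + 1) => ι) (c, y) = Fin.cons c y := rfl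
    rw [hc, ← Fin.cons_snoc_eq_snoc_cons]
    simp only [Fin.cons_zero, Fin.cons_succ]

/-- The sum over closed paths that visit `K` sites in the order given by `π`. -/
noncomputable def cycleSum {ι κ : Type*} [Fintype ι] [Fintype κ] [DecidableEq κ] (π : Equiv.Perm κ)
    (A : κ → Matrix ι ι ℂ) : ℂ :=
  ∑ x : κ → ι, ∏ k, A k (x k) (x (π k))

theorem cycleSum_finRotate {ι : Type*} [Fintype ι] [DecidableEq ι] {K : ℕ} (hK : K ≠ 0)
    (B : Fin K → Matrix ι ι ℂ) :
    cycleSum (finRotate K) B = ((List.ofFn B).prod).trace := by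
  obtain ⟨m, rfl⟩ := Nat.exists_eq_succ_of_ne_zero hK
  rw [cycleSum, Matrix.trace, ← (Fin.consEquiv fun _ : Fin (m + 1) => ι).sum_comp,
    Fintype.sum_prod_type]
  refine Finset.sum_congr rfl fun a _ => ?_
  rw [Matrix.diag_apply, list_ofFn_prod_apply]
  simp only [Fin.snoc_eq_cons_rotate]
  rfl

theorem cycleSum_conj {ι κ κ' : Type*} [Fintype ι] [Fintype κ] [DecidableEq κ]
    [Fintype κ'] [DecidableEq κ'] (π : Equiv.Perm κ) (σ : Equiv.Perm κ') (g : κ' ≃ κ)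
    (hg : ∀ i, π (g i) = g (σ i)) (A : κ → Matrix ι ι ℂ) :
    cycleSum π A = cycleSum σ fun i => A (g i) := by
  unfold cycleSum
  rw [← (g.arrowCongr (Equiv.refl ι)).sum_comp]
  refine Finset.sum_congr rfl fun y _ => ?_
  rw [← g.prod_comp]
  simp [hg]

theorem finRotate_pow_val {K : ℕ} (w : ℕ) (k : Fin K) :
    (((finRotate K ^ w) k : Fin K) : ℕ) = (k + w) % K := by
  induction w with
  | zero => simp [Nat.mod_eq_of_lt k.2]
  | succ w ih =>
    have := k.neZero
    rw [pow_succ', Equiv.Perm.mul_apply, finRotate_apply, Fin.val_add, ih, Fin.val_one']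
    simp [add_assoc]

/-- A nontrivial power of the cyclic shift of prime order is a cycle through all the positions,
which may be started anywhere. -/
theorem exists_equiv_finRotate_pow {K : ℕ} (hK : K.Prime) (t : Fin K) (ht : (t : ℕ) ≠ 0)
    (k₀ : Fin K) : ∃ g : Fin K ≃ Fin K, (g ⟨0, hK.pos⟩ = k₀) ∧
      ∀ i, (finRotate K ^ (t : ℕ)) (g i) = g (finRotate K i) := by
  -- The progression `k₀ + i t` turns the shift by `1` into the shift by `t`, and is injective
  -- because `t` is invertible modulo the prime `K`.
  let f : Fin K → Fin K := fun i => ⟨(k₀ + i * t) % K, Nat.mod_lt _ hK.pos⟩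
  have hf : Function.Injective f := by
    intro i j hij
    have h1 : (k₀ + i * t : ℕ) ≡ k₀ + j * t [MOD K] := congrArg Fin.val hij
    have h2 := Nat.ModEq.add_left_cancel' _ h1
    have hc : Nat.gcd K t = 1 :=
      (Nat.Prime.coprime_iff_not_dvd hK).2 fun h => ht (Nat.eq_zero_of_dvd_of_lt h t.2)
    have h3 := Nat.ModEq.cancel_right_of_coprime hc h2
    exact Fin.ext (by simpa [Nat.ModEq, Nat.mod_eq_of_lt i.2, Nat.mod_eq_of_lt j.2] using h3)
  refine ⟨Equiv.ofBijective f (Finite.injective_iff_bijective.1 hf), ?_, fun i => ?_⟩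
  · simp [f, Nat.mod_eq_of_lt k₀.2]
  · apply Fin.ext
    have h := finRotate_pow_val 1 i
    rw [pow_one] at h
    rw [finRotate_pow_val]
    simp only [Equiv.ofBijective_apply, f, h]
    rw [Nat.mod_add_mod]
    change _ ≡ _ [MOD K]
    have h4 : (i + 1) % K * t ≡ (i + 1) * t [MOD K] := (Nat.mod_modEq _ _).mul_right _
    have h5 := (h4.add_left (k₀ : ℕ)).symm
    convert h5 using 1
    ring

theorem cycleSum_const {ι : Type*} [Fintype ι] [DecidableEq ι] {K : ℕ} (hK : K.Prime)
    (t : Fin K) (ht : (t : ℕ) ≠ 0) (R : Matrix ι ι ℂ) :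
    cycleSum (finRotate K ^ (t : ℕ)) (fun _ => R) = (R ^ K).trace := by
  obtain ⟨g, -, hg⟩ := exists_equiv_finRotate_pow hK t ht ⟨0, hK.pos⟩
  rw [cycleSum_conj _ _ g hg, cycleSum_finRotate hK.ne_zero]
  simp

/-- Hölder's inequality for a cyclic word of matrices: one factor is measured by the functional
`B ↦ Tr (A B)`, the others by the operator norm. -/
theorem norm_cycleSum_le {ι : Type*} [Fintype ι] [DecidableEq ι] {K : ℕ} (hK : K.Prime)
    (t : Fin K) (ht : (t : ℕ) ≠ 0) (A : Fin K → Matrix ι ι ℂ) (k₀ : Fin K) (c : ℝ) (hc : 0 ≤ c)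
    (h₀ : ∀ B : Matrix ι ι ℂ, ‖(A k₀ * B).trace‖ ≤ c * ‖B‖) (b : Fin K → ℝ)
    (hb : ∀ k, ‖A k‖ ≤ b k) :
    ‖cycleSum (finRotate K ^ (t : ℕ)) A‖ ≤ c * ∏ k ∈ Finset.univ.erase k₀, b k := by
  obtain ⟨g, hg₀, hg⟩ := exists_equiv_finRotate_pow hK t ht k₀
  rw [cycleSum_conj _ _ g hg, cycleSum_finRotate hK.ne_zero]
  obtain ⟨m, rfl⟩ := Nat.exists_eq_succ_of_ne_zero hK.ne_zero
  have hg₀' : g 0 = k₀ := hg₀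
  rw [List.ofFn_succ, List.prod_cons, hg₀']
  refine (h₀ _).trans (mul_le_mul_of_nonneg_left ?_ hc)
  have h1 : ‖(1 : Matrix ι ι ℂ)‖ ≤ 1 := by
    rw [← Matrix.diagonal_one, Matrix.l2_opNorm_diagonal]
    exact (pi_norm_le_iff_of_nonneg zero_le_one).2 fun _ => by simp
  refine (norm_list_ofFn_prod_le h1 _ (fun i => b (g i.succ)) fun i => hb _).trans_eq ?_
  have h2 : (Finset.univ.erase k₀) = Finset.univ.image fun i : Fin m => g i.succ := by
    ext k
    simp only [Finset.mem_erase, Finset.mem_univ, and_true, Finset.mem_image, true_and]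
    constructor
    · intro hk
      have : g.symm k ≠ 0 := fun h => hk (by rw [← hg₀', ← h, g.apply_symm_apply])
      obtain ⟨i, hi⟩ := Fin.exists_succ_eq.2 this
      exact ⟨i, by rw [hi, g.apply_symm_apply]⟩
    · rintro ⟨i, rfl⟩ h
      rw [← hg₀'] at h
      exact Fin.succ_ne_zero i (g.injective h)
  rw [h2, Finset.prod_image]
  intro i _ j _ hij
  exact Fin.succ_injective _ (g.injective hij)

/-! ### Norm estimates for partial traces -/

theorem sum_joinBits {n : ℕ} {M : Type*} [AddCommMonoid M] (α : Finset (Fin n))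
    (f : (Fin n → Fin 2) → M) : ∑ c, f c = ∑ a, ∑ e, f (joinBits α a e) := by
  rw [← (Equiv.piEquivPiSubtypeProd (fun i => i ∈ α) fun _ => Fin 2).symm.sum_comp,
    Fintype.sum_prod_type]
  rfl

/-- The component of a state vector along a basis string `e` of the qubits outside `α`. -/
noncomputable def sliceVector {n : ℕ} (α : Finset (Fin n)) (φ : QubitSpace n)
    (e : {i // i ∉ α} → Fin 2) : EuclideanSpace ℂ ({i // i ∈ α} → Fin 2) :=
  WithLp.toLp 2 fun a => φ (joinBits α a e)

theorem sum_norm_sliceVector_sq {n : ℕ} (α : Finset (Fin n)) (φ : QubitSpace n) :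
    ∑ e, ‖sliceVector α φ e‖ ^ 2 = ‖φ‖ ^ 2 := by
  simp only [EuclideanSpace.norm_sq_eq]
  rw [sum_joinBits α, Finset.sum_comm]
  rfl

theorem reducedMatrix_densityMatrix_apply {n : ℕ} (α : Finset (Fin n)) (φ : QubitSpace n)
    (a b : {i // i ∈ α} → Fin 2) : reducedMatrix α (densityMatrix φ) a b =
      ∑ e, sliceVector α φ e a * star (sliceVector α φ e b) := rfl

theorem reducedMatrix_add {n : ℕ} (α : Finset (Fin n))
    (ρ σ : Matrix (Fin n → Fin 2) (Fin n → Fin 2) ℂ) :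
    reducedMatrix α (ρ + σ) = reducedMatrix α ρ + reducedMatrix α σ := by
  ext a b
  simp [reducedMatrix, Finset.sum_add_distrib]

theorem trace_reducedMatrix_densityMatrix_mul {n : ℕ} (α : Finset (Fin n)) (φ : QubitSpace n)
    (B : Matrix ({i // i ∈ α} → Fin 2) ({i // i ∈ α} → Fin 2) ℂ) :
    (reducedMatrix α (densityMatrix φ) * B).trace =
      ∑ e, inner ℂ (sliceVector α φ e) (WithLp.toLp 2 (B.mulVec (sliceVector α φ e))) := by
  simp only [Matrix.trace, Matrix.diag_apply, Matrix.mul_apply, reducedMatrix_densityMatrix_apply,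
    PiLp.inner_apply, Matrix.mulVec, dotProduct, Finset.sum_mul, RCLike.inner_apply]
  refine (Finset.sum_congr rfl fun x _ => Finset.sum_comm).trans (Finset.sum_comm.trans
    (Finset.sum_congr rfl fun e _ => Finset.sum_comm.trans
      (Finset.sum_congr rfl fun a _ => Finset.sum_congr rfl fun b _ => ?_)))
  simp only [RCLike.star_def]
  ring

/-- The reduced matrix is the sum of the rank-one matrices of the slices, so Cauchy–Schwarz applies
slice by slice. This is the trace-norm side of Hölder, stated by duality. -/
theorem norm_trace_reducedMatrix_densityMatrix_mul_le {n : ℕ} (α : Finset (Fin n))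
    (φ : QubitSpace n) (B : Matrix ({i // i ∈ α} → Fin 2) ({i // i ∈ α} → Fin 2) ℂ) :
    ‖(reducedMatrix α (densityMatrix φ) * B).trace‖ ≤ ‖φ‖ ^ 2 * ‖B‖ := by
  rw [trace_reducedMatrix_densityMatrix_mul, ← sum_norm_sliceVector_sq α, Finset.sum_mul]
  refine (norm_sum_le _ _).trans (Finset.sum_le_sum fun e _ => ?_)
  refine (norm_inner_le_norm _ _).trans ?_
  have := Matrix.l2_opNorm_mulVec B (sliceVector α φ e)
  calc _ ≤ ‖sliceVector α φ e‖ * (‖B‖ * ‖sliceVector α φ e‖) := by gcongr; exact this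
    _ = _ := by ring

theorem quadratic_reducedMatrix_densityMatrix {n : ℕ} (α : Finset (Fin n)) (φ : QubitSpace n)
    (v : EuclideanSpace ℂ ({i // i ∈ α} → Fin 2)) :
    star (v : ({i // i ∈ α} → Fin 2) → ℂ) ⬝ᵥ (reducedMatrix α (densityMatrix φ)).mulVec v =
      ((∑ e, ‖inner ℂ v (sliceVector α φ e)‖ ^ 2 : ℝ) : ℂ) := by
  have h : ∀ e, ((‖inner ℂ v (sliceVector α φ e)‖ ^ 2 : ℝ) : ℂ) =
      inner ℂ v (sliceVector α φ e) * inner ℂ (sliceVector α φ e) v := fun e => by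
    rw [← inner_conj_symm (sliceVector α φ e) v, Complex.mul_conj, Complex.normSq_eq_norm_sq]
  rw [Complex.ofReal_sum, Finset.sum_congr rfl fun e _ => h e]
  simp only [PiLp.inner_apply, RCLike.inner_apply, Matrix.mulVec, dotProduct,
    reducedMatrix_densityMatrix_apply, Finset.sum_mul, Finset.mul_sum, Pi.star_apply]
  refine (Finset.sum_congr rfl fun x _ => Finset.sum_comm).trans (Finset.sum_comm.trans
    (Finset.sum_congr rfl fun e _ => Finset.sum_comm.trans
      (Finset.sum_congr rfl fun a _ => Finset.sum_congr rfl fun b _ => ?_)))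
  simp only [RCLike.star_def]
  ring

theorem sum_norm_inner_sliceVector_sq_le {n : ℕ} (α : Finset (Fin n)) (φ : QubitSpace n)
    (v : EuclideanSpace ℂ ({i // i ∈ α} → Fin 2)) :
    ∑ e, ‖inner ℂ v (sliceVector α φ e)‖ ^ 2 ≤ ‖v‖ ^ 2 * ‖φ‖ ^ 2 := by
  rw [← sum_norm_sliceVector_sq α, Finset.mul_sum]
  refine Finset.sum_le_sum fun e _ => ?_
  rw [← mul_pow]
  gcongr
  exact norm_inner_le_norm _ _

theorem isHermitian_densityMatrix {n : ℕ} (φ : QubitSpace n) : (densityMatrix φ).IsHermitian := by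
  ext x y
  simp [densityMatrix, mul_comm]

theorem trace_densityMatrix {n : ℕ} (φ : QubitSpace n) :
    (densityMatrix φ).trace = ((‖φ‖ ^ 2 : ℝ) : ℂ) := by
  simp [densityMatrix, Matrix.trace, EuclideanSpace.norm_sq_eq, Complex.mul_conj,
    Complex.normSq_eq_norm_sq]

theorem Matrix.IsHermitian.reducedMatrix {n : ℕ} (α : Finset (Fin n))
    {H : Matrix (Fin n → Fin 2) (Fin n → Fin 2) ℂ} (hH : H.IsHermitian) :
    (_root_.reducedMatrix α H).IsHermitian := by
  ext a b
  simp only [_root_.reducedMatrix, Matrix.conjTranspose_apply, Matrix.of_apply, star_sum]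
  exact Finset.sum_congr rfl fun e _ => hH.apply _ _

/-- Reduces estimates for Hermitian matrices to those for pure states. -/
theorem reducedMatrix_eq_sum_eigenvalues {n : ℕ} (α : Finset (Fin n))
    {H : Matrix (Fin n → Fin 2) (Fin n → Fin 2) ℂ} (hH : H.IsHermitian) :
    reducedMatrix α H = ∑ i, (hH.eigenvalues i : ℂ) •
      reducedMatrix α (densityMatrix (hH.eigenvectorBasis i)) := by
  ext a b
  simp only [reducedMatrix, Matrix.of_apply, Matrix.sum_apply, Matrix.smul_apply, smul_eq_mul,
    Finset.mul_sum, densityMatrix]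
  rw [Finset.sum_comm]
  exact Finset.sum_congr rfl fun e _ => hH.apply_eq_sum_eigenvalues _ _

theorem norm_trace_reducedMatrix_mul_le {n : ℕ} (α : Finset (Fin n))
    {H : Matrix (Fin n → Fin 2) (Fin n → Fin 2) ℂ} (hH : H.IsHermitian)
    (B : Matrix ({i // i ∈ α} → Fin 2) ({i // i ∈ α} → Fin 2) ℂ) :
    ‖(reducedMatrix α H * B).trace‖ ≤ traceNorm H * ‖B‖ := by
  rw [reducedMatrix_eq_sum_eigenvalues α hH, traceNorm_eq_sum_abs_eigenvalues hH, Finset.sum_mul,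
    Matrix.trace_sum, Finset.sum_mul]
  refine (norm_sum_le _ _).trans (Finset.sum_le_sum fun i _ => ?_)
  rw [Matrix.smul_mul, Matrix.trace_smul, norm_smul, Complex.norm_real, Real.norm_eq_abs]
  gcongr
  simpa using norm_trace_reducedMatrix_densityMatrix_mul_le α (hH.eigenvectorBasis i) B

/-- Partial traces of a traceless Hermitian matrix have operator norm at most half of its
trace norm. -/
theorem norm_reducedMatrix_le {n : ℕ} (α : Finset (Fin n))
    {H : Matrix (Fin n → Fin 2) (Fin n → Fin 2) ℂ} (hH : H.IsHermitian) (h0 : H.trace = 0) :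
    ‖reducedMatrix α H‖ ≤ 1 / 2 * traceNorm H := by
  rw [traceNorm_eq_sum_abs_eigenvalues hH]
  refine (hH.reducedMatrix α).norm_le_of_forall_quadratic (by positivity) fun v hv => ?_
  rw [reducedMatrix_eq_sum_eigenvalues α hH, Matrix.sum_mulVec, dotProduct_sum]
  simp only [Matrix.smul_mulVec, dotProduct_smul, quadratic_reducedMatrix_densityMatrix,
    smul_eq_mul]
  have hsum : ∑ i, hH.eigenvalues i = 0 := by
    have h := hH.trace_eq_sum_eigenvalues
    rw [h0] at h
    have h' : ((∑ i, hH.eigenvalues i : ℝ) : ℂ) = 0 := by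
      rw [Complex.ofReal_sum]
      exact h.symm
    exact_mod_cast h'
  -- `q i` is the quadratic form at `v` of the reduced state of the `i`-th eigenvector, hence lies
  -- in `[0, 1]`.
  set q : (Fin n → Fin 2) → ℝ := fun i =>
    ∑ e, ‖inner ℂ v (sliceVector α (hH.eigenvectorBasis i) e)‖ ^ 2 with hq
  have hq0 : ∀ i, 0 ≤ q i := fun i => Finset.sum_nonneg fun e _ => by positivity
  have hq1 : ∀ i, q i ≤ 1 := fun i => by
    simpa [hv] using sum_norm_inner_sliceVector_sq_le α (hH.eigenvectorBasis i) v
  -- As the eigenvalues sum to zero, `q` may be recentred at `1 / 2`; then `|q i - 1 / 2| ≤ 1 / 2`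
  -- yields the factor one half.
  have hre : ∑ i, (hH.eigenvalues i : ℂ) * (q i : ℂ) =
      ((∑ i, hH.eigenvalues i * (q i - 1 / 2) : ℝ) : ℂ) := by
    simp only [mul_sub, Finset.sum_sub_distrib, ← Finset.sum_mul, hsum]
    simp
  refine (congrArg norm hre).trans_le ?_
  rw [Complex.norm_real, Real.norm_eq_abs, Finset.mul_sum]
  refine (Finset.abs_sum_le_sum_abs _ _).trans (Finset.sum_le_sum fun i _ => ?_)
  rw [abs_mul, mul_comm]
  gcongr
  rw [abs_le]
  constructor <;> linarith [hq0 i, hq1 i]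

theorem norm_reducedMatrix_densityMatrix_le {n : ℕ} (α : Finset (Fin n)) (φ : QubitSpace n) :
    ‖reducedMatrix α (densityMatrix φ)‖ ≤ ‖φ‖ ^ 2 := by
  refine ((isHermitian_densityMatrix φ).reducedMatrix α).norm_le_of_forall_quadratic
    (by positivity) fun v hv => ?_
  rw [quadratic_reducedMatrix_densityMatrix, Complex.norm_real, Real.norm_of_nonneg
    (Finset.sum_nonneg fun e _ => by positivity)]
  simpa [hv] using sum_norm_inner_sliceVector_sq_le α φ v

theorem traceNorm_neg {ι : Type*} [Fintype ι] [DecidableEq ι] (A : Matrix ι ι ℂ) :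
    traceNorm (-A) = traceNorm A := by
  simp only [traceNorm, Matrix.conjTranspose_neg, neg_mul_neg]

theorem traceNorm_nonneg {ι : Type*} [Fintype ι] [DecidableEq ι] (A : Matrix ι ι ℂ) :
    0 ≤ traceNorm A :=
  Finset.sum_nonneg fun _ _ => Real.sqrt_nonneg _

/-! ### Multilinear expansion of the perturbed cyclic trace -/

/-- The sum of all elementary symmetric functions of positive degree, the top one doubled. -/
theorem sum_powerset_erase_empty {K : ℕ} (hK : K ≠ 0) (ε : Fin K → ℝ) :
    ∑ u ∈ Finset.univ.erase (∅ : Finset (Fin K)),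
        (if u = Finset.univ then 2 else 1) * ∏ k ∈ u, ε k =
      (∑ m ∈ Finset.Ico 1 K,
        ∑ u ∈ Finset.powersetCard m (Finset.univ : Finset (Fin K)), ∏ k ∈ u, ε k) +
        2 * ∏ k, ε k := by
  have h1 : ∀ f : Finset (Fin K) → ℝ, ∑ u ∈ Finset.univ.erase (∅ : Finset (Fin K)), f u =
      (∑ m ∈ Finset.Ico 1 K,
        ∑ u ∈ Finset.powersetCard m (Finset.univ : Finset (Fin K)), f u) + f Finset.univ := by
    intro f
    have h2 : ∑ u, f u = f ∅ + ∑ u ∈ Finset.univ.erase (∅ : Finset (Fin K)), f u :=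
      (Finset.add_sum_erase _ _ (Finset.mem_univ _)).symm
    have h3 := Finset.sum_powerset (Finset.univ : Finset (Fin K)) f
    rw [Finset.powerset_univ, h2, Finset.card_univ, Fintype.card_fin, Finset.sum_range_succ,
      Finset.range_eq_Ico, Finset.sum_eq_sum_Ico_succ_bot (Nat.pos_of_ne_zero hK)] at h3
    have h4 : Finset.powersetCard K (Finset.univ : Finset (Fin K)) = {Finset.univ} := by
      simpa using Finset.powersetCard_self (Finset.univ : Finset (Fin K))
    rw [h4] at h3
    simp at h3
    linarith
  rw [h1, if_pos rfl]
  congr 1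
  refine Finset.sum_congr rfl fun m hm => Finset.sum_congr rfl fun u hu => ?_
  rw [if_neg, one_mul]
  rintro rfl
  have := (Finset.mem_powersetCard.1 hu).2
  simp at this hm
  omega

/-- Replacing the copies of `ψ` by nearby states changes the cyclic overlap by at most the sum of
the contributions of all nonempty sets of replaced copies. -/
theorem norm_cycleSum_reducedMatrix_sub_le {K : ℕ} (hK : K.Prime) {n : ℕ} (α : Finset (Fin n))
    (t : Fin K) (ht : (t : ℕ) ≠ 0) (ψ : QubitSpace n) (hψ : ‖ψ‖ = 1)
    (φ : Fin K → QubitSpace n) (hφ : ∀ k, ‖φ k‖ = 1) (ε : Fin K → ℝ)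
    (hε : ∀ k, traceDistance ψ (φ k) = ε k) :
    ‖cycleSum (finRotate K ^ (t : ℕ)) (fun k => reducedMatrix α (densityMatrix (φ k))) -
        cycleSum (finRotate K ^ (t : ℕ)) (fun _ => reducedMatrix α (densityMatrix ψ))‖ ≤
      (∑ m ∈ Finset.Ico 1 K,
        ∑ u ∈ Finset.powersetCard m (Finset.univ : Finset (Fin K)), ∏ k ∈ u, ε k) +
        2 * ∏ k, ε k := by
  rw [← sum_powerset_erase_empty hK.ne_zero]
  set R := reducedMatrix α (densityMatrix ψ) with hR
  let H : Fin K → Matrix (Fin n → Fin 2) (Fin n → Fin 2) ℂ := fun k =>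
    densityMatrix (φ k) - densityMatrix ψ
  have hH : ∀ k, (H k).IsHermitian := fun k =>
    (isHermitian_densityMatrix _).sub (isHermitian_densityMatrix _)
  have hH0 : ∀ k, (H k).trace = 0 := fun k => by
    simp [H, Matrix.trace_sub, trace_densityMatrix, hψ, hφ]
  have hHn : ∀ k, traceNorm (H k) = 2 * ε k := fun k => by
    rw [← hε, traceDistance, ← traceNorm_neg, neg_sub]
    ring
  have hε0 : ∀ k, 0 ≤ ε k := fun k => by
    have := traceNorm_nonneg (H k)
    rw [hHn] at this
    linarith
  let A : Finset (Fin K) → Fin K → Matrix _ _ ℂ := fun u k =>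
    if k ∈ u then reducedMatrix α (H k) else R
  have hexp : cycleSum (finRotate K ^ (t : ℕ)) (fun k => reducedMatrix α (densityMatrix (φ k))) =
      ∑ u, cycleSum (finRotate K ^ (t : ℕ)) (A u) := by
    have hsplit : ∀ k, reducedMatrix α (densityMatrix (φ k)) = reducedMatrix α (H k) + R :=
      fun k => by rw [hR, ← reducedMatrix_add, sub_add_cancel]
    simp only [cycleSum, hsplit, Matrix.add_apply]
    rw [Finset.sum_comm]
    refine Finset.sum_congr rfl fun x _ => ?_
    rw [Fintype.prod_add]
    refine Finset.sum_congr rfl fun u _ => ?_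
    rw [← Finset.prod_mul_prod_compl u]
    congr 1
    · exact Finset.prod_congr rfl fun k hk => by simp [A, hk]
    · exact Finset.prod_congr rfl fun k hk => by simp [A, Finset.mem_compl.1 hk]
  rw [hexp, ← Finset.add_sum_erase _ _ (Finset.mem_univ ∅)]
  have hA0 : A ∅ = fun _ => R := by
    funext k
    simp [A]
  rw [hA0, add_sub_cancel_left]
  refine (norm_sum_le _ _).trans (Finset.sum_le_sum fun u _ => ?_)
  let b : Fin K → ℝ := fun k => if k ∈ u then ε k else 1
  have hAb : ∀ k, ‖A u k‖ ≤ b k := fun k => by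
    by_cases hk : k ∈ u
    · simp only [A, b, if_pos hk]
      refine (norm_reducedMatrix_le α (hH k) (hH0 k)).trans_eq ?_
      rw [hHn]
      ring
    · simp only [A, b, if_neg hk]
      simpa [hψ] using norm_reducedMatrix_densityMatrix_le α ψ
  have hb : ∏ k, b k = ∏ k ∈ u, ε k := by simp [b, Finset.prod_ite_mem]
  -- If every factor is replaced, any position may carry the trace norm `2 * ε k₀`; otherwise an
  -- unreplaced position carries it at cost 1.
  split_ifs with hu
  · let k₀ : Fin K := ⟨0, hK.pos⟩
    refine (norm_cycleSum_le hK t ht (A u) k₀ (2 * ε k₀) (by linarith [hε0 k₀]) ?_ b hAb).trans_eq ?_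
    · intro B
      have := norm_trace_reducedMatrix_mul_le α (hH k₀) B
      rw [hHn] at this
      simpa [A, hu] using this
    · rw [← hb, ← Finset.mul_prod_erase Finset.univ b (Finset.mem_univ k₀)]
      simp only [b, hu, Finset.mem_univ, if_true]
      ring
  · obtain ⟨k₀, hk₀⟩ : ∃ k₀, k₀ ∉ u := by
      by_contra! h
      exact hu (Finset.eq_univ_iff_forall.2 h)
    refine (norm_cycleSum_le hK t ht (A u) k₀ 1 zero_le_one ?_ b hAb).trans_eq ?_
    · intro B
      simpa [A, hk₀, hψ] using norm_trace_reducedMatrix_densityMatrix_mul_le α ψ B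
    · rw [← hb, ← Finset.mul_prod_erase Finset.univ b (Finset.mem_univ k₀)]
      simp [b, hk₀]

end OperatorNorm

/-! ### Fourier analysis on digit strings -/

/-- The primitive root of unity of the Fourier gate. -/
noncomputable def fourierRoot (K : ℕ) : ℂ := Complex.exp (2 * Real.pi * Complex.I / K)

theorem isPrimitiveRoot_fourierRoot {K : ℕ} (hK : K ≠ 0) : IsPrimitiveRoot (fourierRoot K) K :=
  Complex.isPrimitiveRoot_exp K hK

theorem sum_pow_fin_of_pow_eq_one {K : ℕ} {ζ : ℂ} (hζ : ζ ^ K = 1) :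
    ∑ z : Fin K, ζ ^ (z : ℕ) = if ζ = 1 then (K : ℂ) else 0 := by
  rw [Fin.sum_univ_eq_sum_range fun i => ζ ^ i]
  split_ifs with h
  · simp [h]
  · rw [geom_sum_eq h, hζ, sub_self, zero_div]

theorem sum_fourierRoot_pow_mul {K : ℕ} (hK : K ≠ 0) (N : ℕ) :
    ∑ t : Fin K, fourierRoot K ^ ((t : ℕ) * N) = if K ∣ N then (K : ℂ) else 0 := by
  have hω := isPrimitiveRoot_fourierRoot hK
  have h := sum_pow_fin_of_pow_eq_one (K := K) (ζ := fourierRoot K ^ N)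
    (by rw [← pow_mul, mul_comm, pow_mul, hω.pow_eq_one, one_pow])
  simp only [hω.pow_eq_one_iff_dvd] at h
  rw [← h]
  exact Finset.sum_congr rfl fun t _ => by rw [← pow_mul, mul_comm]

theorem star_fourierRoot (K : ℕ) : star (fourierRoot K) = (fourierRoot K)⁻¹ := by
  rw [fourierRoot, ← Complex.exp_neg]
  simp only [RCLike.star_def]
  rw [← Complex.exp_conj]
  congr 1
  simp [neg_div, Complex.conj_ofNat]

theorem sum_fourierRoot_orthogonality {K : ℕ} [NeZero K] (a w v : Fin K) :
    ∑ z : Fin K, fourierRoot K ^ ((z : ℕ) * a) * star (fourierRoot K ^ ((z : ℕ) * w)) *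
      fourierRoot K ^ ((z : ℕ) * v) = if w = v + a then (K : ℂ) else 0 := by
  have hK : K ≠ 0 := NeZero.ne K
  have hω := isPrimitiveRoot_fourierRoot hK
  have h0 : fourierRoot K ≠ 0 := hω.ne_zero hK
  have hp : ∀ m : ℕ, (fourierRoot K ^ m) ^ K = 1 := fun m => by
    rw [← pow_mul, mul_comm, pow_mul, hω.pow_eq_one, one_pow]
  have h := sum_pow_fin_of_pow_eq_one (K := K)
    (ζ := fourierRoot K ^ ((v : ℕ) + a) * (fourierRoot K ^ (w : ℕ))⁻¹)
    (by rw [mul_pow, inv_pow, hp, hp, inv_one, one_mul])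
  have hiff : fourierRoot K ^ ((v : ℕ) + a) * (fourierRoot K ^ (w : ℕ))⁻¹ = 1 ↔ w = v + a := by
    -- Addition in `Fin K` wraps around, which the order `K` of the root absorbs.
    have hmod := pow_mod_orderOf (fourierRoot K) ((v : ℕ) + a)
    rw [← hω.eq_orderOf, ← Fin.val_add] at hmod
    rw [mul_inv_eq_one₀ (pow_ne_zero _ h0), ← hmod]
    exact ⟨fun h => Fin.ext (hω.pow_inj w.2 (v + a).2 h.symm), fun h => by rw [h]⟩
  simp only [hiff] at h
  rw [← h]
  refine Finset.sum_congr rfl fun z _ => ?_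
  rw [star_pow, star_fourierRoot, mul_pow, inv_pow, inv_pow, ← pow_mul, ← pow_mul, add_mul, pow_add,
    mul_comm (v : ℕ), mul_comm (a : ℕ), mul_comm (w : ℕ)]
  ring

/-- Parseval's identity for the discrete Fourier transform, with a modulation. -/
theorem sum_fourier_modulated {K n : ℕ} [NeZero K] (a : Fin n → Fin K)
    (f : (Fin n → Fin K) → ℂ) :
    ∑ z : Fin n → Fin K, (∏ j, fourierRoot K ^ ((z j : ℕ) * a j)) *
      ((∑ w : Fin n → Fin K, (∏ j, star (fourierRoot K ^ ((z j : ℕ) * w j))) * f w) *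
        star (∑ w : Fin n → Fin K, (∏ j, star (fourierRoot K ^ ((z j : ℕ) * w j))) * f w)) =
      (K : ℂ) ^ n * ∑ w, f (w + a) * star (f w) := by
  have horth : ∀ w v : Fin n → Fin K, ∑ z : Fin n → Fin K,
      ∏ j, (fourierRoot K ^ ((z j : ℕ) * a j) * star (fourierRoot K ^ ((z j : ℕ) * w j)) *
        fourierRoot K ^ ((z j : ℕ) * v j)) = if w = v + a then (K : ℂ) ^ n else 0 := by
    intro w v
    have h := Finset.prod_univ_sum (fun _ : Fin n => (Finset.univ : Finset (Fin K)))
      fun j z => fourierRoot K ^ ((z : ℕ) * a j) * star (fourierRoot K ^ ((z : ℕ) * w j)) *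
        fourierRoot K ^ ((z : ℕ) * v j)
    rw [Fintype.piFinset_univ] at h
    rw [← h]
    simp only [sum_fourierRoot_orthogonality]
    rw [Fintype.prod_ite_zero]
    simp [funext_iff]
  calc _ = ∑ z : Fin n → Fin K, ∑ v, ∑ w, (∏ j, (fourierRoot K ^ ((z j : ℕ) * a j) *
        star (fourierRoot K ^ ((z j : ℕ) * w j)) * fourierRoot K ^ ((z j : ℕ) * v j))) *
          (f w * star (f v)) := by
        refine Finset.sum_congr rfl fun z _ => ?_
        rw [star_sum, Finset.mul_sum, Finset.mul_sum]
        refine Finset.sum_congr rfl fun v _ => ?_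
        rw [Finset.sum_mul, Finset.mul_sum]
        refine Finset.sum_congr rfl fun w _ => ?_
        rw [star_mul', star_prod]
        simp only [star_star, Finset.prod_mul_distrib]
        ring
    _ = ∑ v, ∑ w, (if w = v + a then (K : ℂ) ^ n else 0) * (f w * star (f v)) := by
        rw [Finset.sum_comm]
        refine Finset.sum_congr rfl fun v _ => ?_
        rw [Finset.sum_comm]
        refine Finset.sum_congr rfl fun w _ => ?_
        rw [← horth, Finset.sum_mul]
    _ = _ := by
        rw [Finset.mul_sum]
        refine Finset.sum_congr rfl fun v _ => ?_
        simp

/-! ### The circuit as a superposition of relabelled copies -/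

theorem derangementGate_pow_apply (K w : ℕ) (y x : Fin K → Fin 2) :
    (derangementGate K ^ w) y x = if y = fun k => x ((finRotate K ^ w) k) then 1 else 0 := by
  induction w generalizing y x with
  | zero => simp [Matrix.one_apply]
  | succ w ih =>
    rw [pow_succ, Matrix.mul_apply]
    simp only [ih]
    simp only [derangementGate, Matrix.of_apply, mul_ite, mul_one, mul_zero, Finset.sum_ite_eq',
      Finset.mem_univ, if_true, pow_succ']
    rfl

/-- The relabelling of the copies of qubit `j` by the inverse of the `w j`-th power of the cyclic
shift. -/
def shiftCopies {K n : ℕ} (w : Fin n → Fin K) :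
    (Fin K → Fin n → Fin 2) ≃ (Fin K → Fin n → Fin 2) where
  toFun c k j := c ((finRotate K ^ (w j : ℕ)).symm k) j
  invFun c k j := c ((finRotate K ^ (w j : ℕ)) k) j
  left_inv c := by simp
  right_inv c := by simp

theorem shiftCopies_apply {K n : ℕ} (w : Fin n → Fin K) (c : Fin K → Fin n → Fin 2) (k : Fin K)
    (j : Fin n) : shiftCopies w c k j = c ((finRotate K ^ (w j : ℕ)).symm k) j := rfl

theorem finRotate_pow_card (K : ℕ) : finRotate K ^ K = 1 := by
  ext k
  rw [finRotate_pow_val]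
  simp [Nat.mod_eq_of_lt k.2]

theorem shiftCopies_zero {K n : ℕ} [NeZero K] (c : Fin K → Fin n → Fin 2) :
    shiftCopies (0 : Fin n → Fin K) c = c := by
  funext k j
  rw [shiftCopies_apply]
  simp
  rfl

/-- The digitwise sum `w + a` is reduced modulo `K`; this is harmless because the `K`-th power of
the shift is the identity. -/
theorem shiftCopies_add {K n : ℕ} [NeZero K] (w a : Fin n → Fin K)
    (c : Fin K → Fin n → Fin 2) :
    shiftCopies (w + a) c = shiftCopies a (shiftCopies w c) := by
  funext k j
  simp only [shiftCopies_apply, Pi.add_apply, Fin.val_add]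
  congr 1
  rw [← pow_mod_orderOf, Nat.mod_mod_of_dvd _ (orderOf_dvd_of_pow_eq_one (finRotate_pow_card K)),
    pow_mod_orderOf, add_comm, pow_add]
  rfl

/-- The amplitude of the product state of the copies. -/
noncomputable def productState {K n : ℕ} (ψ : Fin K → QubitSpace n)
    (c : Fin K → Fin n → Fin 2) : ℂ :=
  ∏ k, ψ k (c k)

/-- Solving for the column index `d` in terms of the row `c` inverts the shift, hence the inverse
powers in `shiftCopies`. -/
theorem prod_derangementGate_pow_apply {K n : ℕ} (w : Fin n → Fin K)
    (c d : Fin K → Fin n → Fin 2) :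
    ∏ j, (derangementGate K ^ (w j : ℕ)) (fun k => c k j) (fun k => d k j) =
      if d = shiftCopies w c then 1 else 0 := by
  simp only [derangementGate_pow_apply]
  rw [Fintype.prod_ite_zero]
  simp only [Finset.prod_const_one]
  refine if_congr ?_ rfl rfl
  rw [← Equiv.symm_apply_eq]
  constructor
  · intro h
    funext k j
    exact (congrFun (h j) k).symm
  · rintro rfl j
    rfl

theorem fourierLayer_mulVec_circuitInput {K n : ℕ} [NeZero K] (ψ : Fin K → QubitSpace n)
    (u : CircuitBasis K n) : (fourierLayer K n).mulVec (circuitInput ψ) u =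
      (1 / (Real.sqrt K : ℂ)) ^ n * productState ψ u.2 := by
  have h0 : ∀ w : Fin n → Fin K, (∀ j, (w j : ℕ) = 0) ↔ w = 0 := fun w => by
    simp [funext_iff]
  simp only [Matrix.mulVec, dotProduct, fourierLayer, circuitInput, Matrix.of_apply,
    Fintype.sum_prod_type, h0]
  simp [fourierGate, productState, mul_assoc]

theorem controlledLayer_mulVec {K n : ℕ} (f : CircuitBasis K n → ℂ) (u : CircuitBasis K n) :
    (controlledLayer K n).mulVec f u = f (u.1, shiftCopies u.1 u.2) := by
  simp only [Matrix.mulVec, dotProduct, controlledLayer, Matrix.of_apply, Fintype.sum_prod_type,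
    prod_derangementGate_pow_apply]
  simp [ite_mul]

theorem circuitOutput_apply {K n : ℕ} [NeZero K] (ψ : Fin K → QubitSpace n) (z : Fin n → Fin K)
    (c : Fin K → Fin n → Fin 2) : circuitOutput ψ (z, c) = (1 / (K : ℂ)) ^ n *
      ∑ w : Fin n → Fin K, (∏ j, star (fourierRoot K ^ ((z j : ℕ) * w j))) *
        productState ψ (shiftCopies w c) := by
  have hs : (1 / (Real.sqrt K : ℂ)) * (1 / (Real.sqrt K : ℂ)) = 1 / (K : ℂ) := by
    rw [div_mul_div_comm, one_mul, ← Complex.ofReal_mul, Real.mul_self_sqrt (Nat.cast_nonneg K)]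
    simp
  rw [circuitOutput, ← Matrix.mulVec_mulVec, ← Matrix.mulVec_mulVec]
  rw [Matrix.mulVec, dotProduct, Fintype.sum_prod_type, Finset.mul_sum]
  refine Finset.sum_congr rfl fun w _ => ?_
  simp only [controlledLayer_mulVec, fourierLayer_mulVec_circuitInput]
  have hterm : ∀ d : Fin K → Fin n → Fin 2,
      (fourierLayer K n).conjTranspose (z, c) (w, d) = if d = c then
        (1 / (Real.sqrt K : ℂ)) ^ n * ∏ j, star (fourierRoot K ^ ((z j : ℕ) * w j)) else 0 := by
    intro d
    simp only [Matrix.conjTranspose_apply, fourierLayer, Matrix.of_apply, fourierGate,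
      ← fourierRoot.eq_1]
    split_ifs with h
    · rw [mul_one, star_prod]
      simp [Finset.prod_mul_distrib]
    · simp
  simp only [hterm, ite_mul, zero_mul, Finset.sum_ite_eq', Finset.mem_univ, if_true]
  rw [← hs, mul_pow]
  ring

/-- The expectation of the product of the powers `D ^ (a j)` in the product state. -/
noncomputable def shiftOverlap {K n : ℕ} (ψ : Fin K → QubitSpace n) (a : Fin n → Fin K) : ℂ :=
  ∑ c, productState ψ (shiftCopies a c) * star (productState ψ c)

/-- The characteristic function of the outcome distribution. -/
theorem sum_fourierRoot_mul_outcomeProb {K n : ℕ} [NeZero K] (ψ : Fin K → QubitSpace n)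
    (a : Fin n → Fin K) :
    ∑ z : Fin n → Fin K, (∏ j, fourierRoot K ^ ((z j : ℕ) * a j)) * (outcomeProb ψ z : ℂ) =
      shiftOverlap ψ a := by
  have hK : (K : ℂ) ≠ 0 := Nat.cast_ne_zero.2 (NeZero.ne K)
  have hp : ∀ z, (outcomeProb ψ z : ℂ) = ((1 / (K : ℂ)) ^ n * (1 / (K : ℂ)) ^ n) * ∑ c,
      ((∑ w : Fin n → Fin K, (∏ j, star (fourierRoot K ^ ((z j : ℕ) * w j))) *
        productState ψ (shiftCopies w c)) *
      star (∑ w : Fin n → Fin K, (∏ j, star (fourierRoot K ^ ((z j : ℕ) * w j))) *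
        productState ψ (shiftCopies w c))) := by
    intro z
    rw [outcomeProb, Complex.ofReal_sum, Finset.mul_sum]
    refine Finset.sum_congr rfl fun c _ => ?_
    rw [← Complex.normSq_eq_norm_sq, ← Complex.mul_conj, circuitOutput_apply, map_mul,
      RCLike.star_def]
    have hr : (starRingEnd ℂ) ((1 / (K : ℂ)) ^ n) = (1 / (K : ℂ)) ^ n := by simp
    rw [hr]
    ring
  simp only [hp]
  -- Parseval is applied for each fixed `c`, to the amplitude as a function of the shift `w`.
  have hswap := Finset.sum_congr (rfl : (Finset.univ : Finset (Fin K → Fin n → Fin 2)) = _)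
    fun c _ => sum_fourier_modulated a fun w => productState ψ (shiftCopies w c)
  rw [Finset.sum_comm] at hswap
  simp only [← Finset.mul_sum] at hswap
  calc _ = ((1 / (K : ℂ)) ^ n * (1 / (K : ℂ)) ^ n) * ∑ z : Fin n → Fin K,
      (∏ j, fourierRoot K ^ ((z j : ℕ) * a j)) * ∑ c,
      ((∑ w : Fin n → Fin K, (∏ j, star (fourierRoot K ^ ((z j : ℕ) * w j))) *
        productState ψ (shiftCopies w c)) *
      star (∑ w : Fin n → Fin K, (∏ j, star (fourierRoot K ^ ((z j : ℕ) * w j))) *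
        productState ψ (shiftCopies w c))) := by
        rw [Finset.mul_sum]
        exact Finset.sum_congr rfl fun z _ => by ring
    _ = _ := by
        rw [hswap, Finset.sum_comm]
        -- Relabelling `c` makes all `K ^ n` values of `w` contribute equally; with the `K ^ n` from
        -- Parseval this cancels the squared normalization.
        have hshift : ∀ w : Fin n → Fin K, ∑ c, productState ψ (shiftCopies (w + a) c) *
            star (productState ψ (shiftCopies w c)) = shiftOverlap ψ a := fun w => by
          rw [shiftOverlap]
          conv_rhs => rw [← (shiftCopies w).sum_comp]
          simp only [shiftCopies_add]
        simp only [hshift, Finset.sum_const, Finset.card_univ, Fintype.card_fun, Fintype.card_fin,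
          nsmul_eq_mul, Nat.cast_pow, one_div, inv_pow]
        field_simp

/-- The exponents of the derangement acting with power `t` on the qubits in `α` only. -/
def uniformShift {K n : ℕ} [NeZero K] (α : Finset (Fin n)) (t : Fin K) : Fin n → Fin K :=
  fun j => if j ∈ α then t else 0

theorem sum_outcomeProb_dvd {K n : ℕ} [NeZero K] (ψ : Fin K → QubitSpace n)
    (α : Finset (Fin n)) :
    ((∑ z : Fin n → Fin K with K ∣ ∑ x ∈ α, (z x : ℕ), outcomeProb ψ z : ℝ) : ℂ) =
      1 / (K : ℂ) * ∑ t : Fin K, shiftOverlap ψ (uniformShift α t) := by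
  have hK : (K : ℂ) ≠ 0 := Nat.cast_ne_zero.2 (NeZero.ne K)
  simp only [← sum_fourierRoot_mul_outcomeProb]
  rw [Finset.sum_comm, Finset.sum_filter, Complex.ofReal_sum, Finset.mul_sum]
  refine Finset.sum_congr rfl fun z _ => ?_
  have hχ : ∀ t : Fin K, ∏ j, fourierRoot K ^ ((z j : ℕ) * uniformShift α t j) =
      fourierRoot K ^ ((t : ℕ) * ∑ x ∈ α, (z x : ℕ)) := fun t => by
    rw [Finset.prod_pow_eq_pow_sum, Finset.mul_sum]
    congr 1
    rw [← Finset.sum_subset (Finset.subset_univ α)]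
    · exact Finset.sum_congr rfl fun j hj => by simp [uniformShift, hj, mul_comm]
    · intro j _ hj
      simp [uniformShift, hj]
  simp only [hχ]
  rw [← Finset.sum_mul, sum_fourierRoot_pow_mul (NeZero.ne K)]
  split_ifs with h
  · field_simp
  · simp

/-! ### Shift overlaps as cyclic traces -/

theorem sum_prod_fin {κ : Type*} [Fintype κ] {K : ℕ} (g : Fin K → κ → ℂ) :
    ∑ e : Fin K → κ, ∏ k, g k (e k) = ∏ k, ∑ e, g k e := by
  classical
  rw [Finset.prod_univ_sum, Fintype.piFinset_univ]

theorem shiftOverlap_zero {K n : ℕ} [NeZero K] (ψ : Fin K → QubitSpace n)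
    (hψ : ∀ k, ‖ψ k‖ = 1) : shiftOverlap ψ 0 = 1 := by
  simp only [shiftOverlap, shiftCopies_zero, productState, star_prod, ← Finset.prod_mul_distrib]
  rw [sum_prod_fin fun k e => ψ k e * star (ψ k e)]
  refine Finset.prod_eq_one fun k _ => ?_
  have h := trace_densityMatrix (ψ k)
  simp only [hψ, one_pow, Complex.ofReal_one] at h
  exact h

theorem sum_joinBits_copies {K n : ℕ} (α : Finset (Fin n)) (f : (Fin K → Fin n → Fin 2) → ℂ) :
    ∑ c, f c = ∑ x : Fin K → {i // i ∈ α} → Fin 2, ∑ e : Fin K → {i // i ∉ α} → Fin 2,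
      f fun k => joinBits α (x k) (e k) := by
  let E := Equiv.piEquivPiSubtypeProd (fun i : Fin n => i ∈ α) fun _ => Fin 2
  rw [← ((Equiv.refl (Fin K)).arrowCongr E.symm).sum_comp,
    ← (Equiv.arrowProdEquivProdArrow (Fin K) (fun _ => {i // i ∈ α} → Fin 2)
      (fun _ => {i // i ∉ α} → Fin 2)).symm.sum_comp, Fintype.sum_prod_type]
  rfl

/-- Off `α` the shift is trivial, so those bits are summed within each copy, which is the partial
trace; on `α` the shift links copy `k` to its image. -/
theorem shiftOverlap_uniformShift {K n : ℕ} [NeZero K] (ψ : Fin K → QubitSpace n)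
    (α : Finset (Fin n)) (t : Fin K) : shiftOverlap ψ (uniformShift α t) =
      cycleSum (finRotate K ^ (t : ℕ)) fun k => reducedMatrix α (densityMatrix (ψ k)) := by
  have hjoin : ∀ (x : Fin K → {i // i ∈ α} → Fin 2) (e : Fin K → {i // i ∉ α} → Fin 2) (k : Fin K),
      shiftCopies (uniformShift α t) (fun k => joinBits α (x k) (e k)) k =
        joinBits α (x ((finRotate K ^ (t : ℕ)).symm k)) (e k) := by
    intro x e k
    funext j
    rw [shiftCopies_apply]
    by_cases hj : j ∈ α
    · simp [joinBits, uniformShift, hj]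
    · simp [joinBits, uniformShift, hj]
      rfl
  rw [shiftOverlap, sum_joinBits_copies α, cycleSum,
    -- Reindexing the bits on `α` moves the inverse shift from the ket to a forward shift on the
    -- bra.
    ← ((finRotate K ^ (t : ℕ)).symm.arrowCongr (Equiv.refl _)).sum_comp]
  refine Finset.sum_congr rfl fun x _ => ?_
  have hx : ∀ k, (finRotate K ^ (t : ℕ)).symm.arrowCongr (Equiv.refl _) x k =
      x ((finRotate K ^ (t : ℕ)) k) := fun k => rfl
  simp only [productState, hjoin, star_prod, ← Finset.prod_mul_distrib, hx, Equiv.apply_symm_apply]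
  exact sum_prod_fin fun k e => ψ k (joinBits α (x k) e) *
    star (ψ k (joinBits α (x ((finRotate K ^ (t : ℕ)) k)) e))

theorem uniformShift_zero {K n : ℕ} [NeZero K] (α : Finset (Fin n)) :
    uniformShift α (0 : Fin K) = 0 := by
  funext j
  simp [uniformShift]

theorem uniformShift_empty {K n : ℕ} [NeZero K] (t : Fin K) :
    uniformShift (∅ : Finset (Fin n)) t = 0 := by
  funext j
  simp [uniformShift]

theorem shiftOverlap_const {K n : ℕ} [NeZero K] (hK : K.Prime) (ψ : QubitSpace n)
    (α : Finset (Fin n)) (t : Fin K) (ht : (t : ℕ) ≠ 0) :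
    shiftOverlap (fun _ => ψ) (uniformShift α t) =
      (reducedMatrix α (densityMatrix ψ) ^ K).trace := by
  rw [shiftOverlap_uniformShift, cycleSum_const hK t ht]

/-! ### Comparison of the estimated and the exact GCE -/

theorem one_sub_sum_outcomeProb {K n : ℕ} [NeZero K] (ψ : Fin K → QubitSpace n)
    (hψ : ∀ k, ‖ψ k‖ = 1) (α : Finset (Fin n)) :
    1 - ∑ z : Fin n → Fin K with K ∣ ∑ x ∈ α, (z x : ℕ), outcomeProb ψ z =
      1 / (K : ℝ) * ∑ t ∈ Finset.univ.erase (0 : Fin K),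
        (1 - (shiftOverlap ψ (uniformShift α t)).re) := by
  have hK : (K : ℝ) ≠ 0 := Nat.cast_ne_zero.2 (NeZero.ne K)
  have h := congrArg Complex.re (sum_outcomeProb_dvd ψ α)
  rw [Complex.ofReal_re] at h
  have hcast : (1 / (K : ℂ)) = ((1 / (K : ℝ) : ℝ) : ℂ) := by push_cast; rfl
  rw [hcast, Complex.re_ofReal_mul, Complex.re_sum] at h
  have h0 : (shiftOverlap ψ (uniformShift α (0 : Fin K))).re = 1 := by
    rw [uniformShift_zero, shiftOverlap_zero ψ hψ, Complex.one_re]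
  have hsum : ∑ t : Fin K, (1 - (shiftOverlap ψ (uniformShift α t)).re) =
      ∑ t ∈ Finset.univ.erase (0 : Fin K), (1 - (shiftOverlap ψ (uniformShift α t)).re) := by
    rw [← Finset.add_sum_erase _ _ (Finset.mem_univ (0 : Fin K)), h0, sub_self, zero_add]
  rw [h, ← hsum, Finset.sum_sub_distrib]
  simp only [Finset.sum_const, Finset.card_univ, Fintype.card_fin, nsmul_eq_mul]
  field_simp

theorem abs_sum_trace_sub_shiftOverlap_le {K n : ℕ} [NeZero K] (hK : K.Prime)
    (ψ : QubitSpace n) (hψ : ‖ψ‖ = 1) (φ : Fin K → QubitSpace n) (hφ : ∀ k, ‖φ k‖ = 1)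
    (ε : Fin K → ℝ) (hε : ∀ k, traceDistance ψ (φ k) = ε k) (α : Finset (Fin n)) :
    |∑ t ∈ Finset.univ.erase (0 : Fin K), ((reducedMatrix α (densityMatrix ψ) ^ K).trace.re -
        (shiftOverlap φ (uniformShift α t)).re)| ≤
      ((K : ℝ) - 1) * ((∑ m ∈ Finset.Ico 1 K,
        ∑ u ∈ Finset.powersetCard m (Finset.univ : Finset (Fin K)), ∏ k ∈ u, ε k) +
          2 * ∏ k, ε k) := by
  have hcard : (((Finset.univ.erase (0 : Fin K)).card : ℕ) : ℝ) = (K : ℝ) - 1 := by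
    rw [Finset.card_erase_of_mem (Finset.mem_univ _), Finset.card_univ, Fintype.card_fin,
      Nat.cast_sub hK.one_le, Nat.cast_one]
  rw [← hcard, ← nsmul_eq_mul]
  refine (Finset.abs_sum_le_sum_abs _ _).trans (Finset.sum_le_card_nsmul _ _ _ fun t ht => ?_)
  have ht0 : (t : ℕ) ≠ 0 := fun h => Finset.ne_of_mem_erase ht (Fin.ext (by simpa using h))
  rw [← Complex.sub_re, ← cycleSum_const hK t ht0, shiftOverlap_uniformShift]
  refine (Complex.abs_re_le_norm _).trans ?_
  rw [norm_sub_rev]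
  exact norm_cycleSum_reducedMatrix_sub_le hK α t ht0 ψ hψ φ hφ ε hε

theorem sum_trace_sub_shiftOverlap_empty {K n : ℕ} [NeZero K] (hK : K.Prime)
    (ψ : QubitSpace n) (hψ : ‖ψ‖ = 1) (φ : Fin K → QubitSpace n) (hφ : ∀ k, ‖φ k‖ = 1) :
    ∑ t ∈ Finset.univ.erase (0 : Fin K),
      ((reducedMatrix (∅ : Finset (Fin n)) (densityMatrix ψ) ^ K).trace.re -
        (shiftOverlap φ (uniformShift ∅ t)).re) = 0 := by
  refine Finset.sum_eq_zero fun t ht => ?_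
  have ht0 : (t : ℕ) ≠ 0 := fun h => Finset.ne_of_mem_erase ht (Fin.ext (by simpa using h))
  rw [← shiftOverlap_const hK ψ ∅ t ht0, uniformShift_empty, shiftOverlap_zero _ fun _ => hψ,
    shiftOverlap_zero φ hφ, sub_self]

/-- The prefactor `K` cancels the `1 / K` of the character average, and the exact GCE is spread over
the `K - 1` values `t ≠ 0`, so the constants 1 cancel term by term. -/
theorem estimatedGCE_sub_gce {K n : ℕ} [NeZero K] (hK : K.Prime) (s : Finset (Fin n))
    (ψ : QubitSpace n) (φ : Fin K → QubitSpace n) (hφ : ∀ k, ‖φ k‖ = 1) :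
    estimatedGCE φ s - gce K ψ s = 1 / (2 ^ s.card * ((K : ℝ) - 1) ^ 2) * ∑ α ∈ s.powerset,
      ∑ t ∈ Finset.univ.erase (0 : Fin K), ((reducedMatrix α (densityMatrix ψ) ^ K).trace.re -
        (shiftOverlap φ (uniformShift α t)).re) := by
  have hK0 : (K : ℝ) ≠ 0 := Nat.cast_ne_zero.2 hK.ne_zero
  have hK1 : (K : ℝ) - 1 ≠ 0 := sub_ne_zero.2 (by exact_mod_cast hK.one_lt.ne')
  have hcard : (((Finset.univ.erase (0 : Fin K)).card : ℕ) : ℝ) = (K : ℝ) - 1 := by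
    rw [Finset.card_erase_of_mem (Finset.mem_univ _), Finset.card_univ, Fintype.card_fin,
      Nat.cast_sub hK.one_le, Nat.cast_one]
  simp only [estimatedGCE, gce, one_sub_sum_outcomeProb φ hφ, Finset.sum_sub_distrib,
    Finset.sum_const, nsmul_eq_mul, hcard, Finset.card_powerset, Nat.cast_pow, Nat.cast_ofNat,
    ← Finset.mul_sum, mul_one]
  field_simp
  ring

theorem proposition3 (K : ℕ) (hK : K.Prime) (n : ℕ) (s : Finset (Fin n)) (hs : s.Nonempty)
    (ψ : QubitSpace n) (hψ : ‖ψ‖ = 1)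
    (ψ' : Fin K → QubitSpace n) (hψ' : ∀ k, ‖ψ' k‖ = 1)
    (ε : Fin K → ℝ) (hε : ∀ k, traceDistance ψ (ψ' k) = ε k) :
    |estimatedGCE ψ' s - gce K ψ s| ≤
      ((2 : ℝ) ^ s.card - 1) / (((K : ℝ) - 1) * 2 ^ s.card) *
        ((∑ m ∈ Finset.Ico 1 K,
            ∑ t ∈ Finset.powersetCard m (Finset.univ : Finset (Fin K)), ∏ k ∈ t, ε k) +
          2 * ∏ k, ε k) := by

  have : NeZero K := ⟨hK.ne_zero⟩
  rw [estimatedGCE_sub_gce hK s ψ ψ' hψ', ← Finset.add_sum_erase _ _ (Finset.empty_mem_powerset s),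
    sum_trace_sub_shiftOverlap_empty hK ψ hψ ψ' hψ', zero_add, abs_mul]
  have hK1 : 0 < (K : ℝ) - 1 := sub_pos.2 (by exact_mod_cast hK.one_lt)
  have hcard : (((s.powerset.erase ∅).card : ℕ) : ℝ) = 2 ^ s.card - 1 := by
    rw [Finset.card_erase_of_mem (Finset.empty_mem_powerset s), Finset.card_powerset,
      Nat.cast_sub Nat.one_le_two_pow]
    simp
  have hsum := (Finset.abs_sum_le_sum_abs _ _).trans
    (Finset.sum_le_card_nsmul (s.powerset.erase ∅) _ _ fun α _ =>
      abs_sum_trace_sub_shiftOverlap_le hK ψ hψ ψ' hψ' ε hε α)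
  rw [nsmul_eq_mul, hcard] at hsum
  have hpos : 0 < 1 / ((2 : ℝ) ^ s.card * ((K : ℝ) - 1) ^ 2) := by positivity
  rw [abs_of_pos hpos]
  -- The `K - 1` nonzero values of `t` cancel one of the two factors `K - 1` in the denominator.
  refine (mul_le_mul_of_nonneg_left hsum hpos.le).trans_eq ?_
  field_simp
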